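/- **Setting.** Let $E$ be a real Banach space with dual $E^*$, uniformly convex and uniformly smooth (the limit $\lim_{t\to0}(\|x+ty\|-\|x\|)/t$ exists uniformly for $x,y$ in the unit sphere). Let $J:E\to E^*$ be the normalized duality mapping: $Jx$ is the unique $x^*\in E^*$ with $\langle x,x^*\rangle=\|x\|\,\|x^*\|$ and $\|x^*\|=\|x\|$. Put $\phi(x,y)=\|x\|^2-2\langle x,Jy\rangle+\|y\|^2$. For a set $D\subseteq E$ and $x\in E$ let $\Pi_D x$ be the point $p\in D$ with $\phi(p,x)=\min_{y\in D}\phi(y,x)$. Let $C\subseteq E$ be nonempty, closed and convex. Let $F:C\times C\to\mathbb R$ satisfy - (A1) $F(x,x)=0$ for all $x\in C$; - (A2) $F(x,y)+F(y,x)\le0$ for all $x,y\in C$; - (A3) $\limsup_{t\to0^+}F(tz+(1-t)x,y)\le F(x,y)$ for all $x,y,z\in C$; - (A4) $F(x,\cdot)$ is convex and lower semicontinuous on $C$ for each $x\in C$. Let $EP(F)=\{x\in C: F(x,y)\ge0\ \ \forall y\in C\}$. A multivalued map $T$ on $C$ assigns to each $x\in C$ a nonempty subset $Tx\subseteq C$;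 its fixed point set is $F(T)=\{p\in C:p\in Tp\}$. It is *closed* if $x_n\in C$, $x_n\to w$ and $\operatorname{dist}(x_n,Tx_n)\to0$ imply $w\in Tw$. For nonempty $A,B\subseteq C$ let $$\Phi(A,B)=\max\Big\{\sup_{q\in B}\inf_{y\in A}\phi(y,q),\ \sup_{y\in A}\inf_{q\in B}\phi(y,q)\Big\}\in[0,\infty].$$ $T$ is *relatively quasi-nonexpansive* if $F(T)\ne\emptyset$ and $\Phi(Tp,Tx)\le\phi(p,x)$ for all $p\in F(T)$ and $x\in C$. **Theorem 3.2.** Let $T_i$ ($i=1,2,\dots$) be closed relatively quasi-nonexpansive multivalued maps on $C$ such that $\mathcal F=\bigcap_{i\ge1}F(T_i)\cap EP(F)\neq\emptyset$ and $T_i(p)=\{p\}$ for all $p\in\mathcal F$ and $i\ge1$. Let $a_{n,i}\ge0$ ($n,i\ge0$) with $\sum_{i=0}^\infty a_{n,i}=1$ for every $n$ and $\liminf_n a_{n,0}a_{n,i}>0$ for every $i\ge1$; let $r_n>0$ with $\liminf_n r_n>0$. Let $x_0\in C$, $C_0=C$, and let $(x_n)$ be any sequence generated, for $n\ge0$, by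 $$\begin{cases}z_{n,i}\in T_ix_n\quad(i\ge1),\\ y_n=J^{-1}\big(a_{n,0}Jx_n+\sum_{i=1}^\infty a_{n,i}Jz_{n,i}\big),\\ u_n\in C:\ F(u_n,v)+\frac1{r_n}\langle v-u_n,Ju_n-Jy_n\rangle\ge0\quad\forall v\in C,\\ C_{n+1}=\{v\in C_n:\phi(v,u_n)\le\phi(v,x_n)\},\\ x_{n+1}=\Pi_{C_{n+1}}x_0.\end{cases}$$ Then $\phi(\cdot,x_0)$ has exactly one minimizer $\Pi_{\mathcal F}x_0$ on $\mathcal F$, and $x_n\to\Pi_{\mathcal F}x_0$ in norm. -/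

import Mathlib

open Filter Topology

namespace ShrinkingProjection

section Duality

variable {E : Type*} [NormedAddCommGroup E] [NormedSpace ℝ E]

/-- The normalized duality mapping as a set-valued map:
`J x = {x* : ⟨x, x*⟩ = ‖x‖ ‖x*‖, ‖x‖ = ‖x*‖}`. -/
def dualitySet (x : E) : Set (StrongDual ℝ E) :=
  {f | f x = ‖x‖ * ‖f‖ ∧ ‖x‖ = ‖f‖}

/-- The set `J x` is nonempty (Hahn-Banach). -/
theorem dualitySet_nonempty (x : E) : (dualitySet x).Nonempty := by
  rcases eq_or_ne x 0 with rfl | hx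
  · exact ⟨0, by simp [dualitySet]⟩
  · obtain ⟨g, hg, hgx⟩ := exists_dual_vector ℝ x (by simpa using hx)
    refine ⟨‖x‖ • g, ?_, ?_⟩
    · simp [norm_smul, hg, hgx]
    · simp [norm_smul, hg]

/-- The normalized duality mapping `J : E → E*` as a function. In a smooth space (the only case in
which it is used) the set `J x` has exactly one element, and this is that element. -/
noncomputable def J (x : E) : StrongDual ℝ E :=
  (dualitySet_nonempty x).some

/-- The Lyapunov functional `φ(x, y) = ‖x‖² - 2 ⟨x, J y⟩ + ‖y‖²`. -/
noncomputable def phi (x y : E) : ℝ :=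
  ‖x‖ ^ 2 - 2 * J y x + ‖y‖ ^ 2

/-- `Φ(A, B) = max {sup_{q ∈ B} inf_{y ∈ A} φ(y, q), sup_{y ∈ A} inf_{q ∈ B} φ(y, q)}`, with values
in the extended reals since the sets may be unbounded. -/
noncomputable def Phi (A B : Set E) : EReal :=
  max (⨆ q ∈ B, ⨅ y ∈ A, (phi y q : EReal)) (⨆ y ∈ A, ⨅ q ∈ B, (phi y q : EReal))

/-- `p` is a value of the generalized projection of `x` on `D`, that is `p ∈ D` and
`φ(p, x) = min_{y ∈ D} φ(y, x)`. -/
def IsGenProj (D : Set E) (x p : E) : Prop :=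
  p ∈ D ∧ ∀ y ∈ D, phi p x ≤ phi y x

/-- The set of fixed points of a multivalued mapping `T` on `C`. -/
def fixedPts (C : Set E) (T : E → Set E) : Set E :=
  {p | p ∈ C ∧ p ∈ T p}

/-- `T` maps `C` into the nonempty subsets of `C`. -/
def IsMultiMap (C : Set E) (T : E → Set E) : Prop :=
  ∀ x ∈ C, (T x).Nonempty ∧ T x ⊆ C

/-- Relatively quasi-nonexpansive multivalued mappings: `F(T) ≠ ∅` and `Φ(Tp, Tx) ≤ φ(p, x)` for
every fixed point `p` and every `x ∈ C`. For a single-valued `T` this is `φ(p, Tx) ≤ φ(p, x)`. -/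
def RelQuasiNonexpansive (C : Set E) (T : E → Set E) : Prop :=
  (fixedPts C T).Nonempty ∧
    ∀ p ∈ fixedPts C T, ∀ x ∈ C, Phi (T p) (T x) ≤ (phi p x : EReal)

/-- Closed multivalued mappings: if `xₙ → w` in `C` and `dist(xₙ, T xₙ) → 0`, then `w ∈ T w`. -/
def ClosedMulti (C : Set E) (T : E → Set E) : Prop :=
  ∀ (x : ℕ → E) (w : E), (∀ n, x n ∈ C) → w ∈ C → Tendsto x atTop (𝓝 w) →
    Tendsto (fun n => Metric.infDist (x n) (T (x n))) atTop (𝓝 0) → w ∈ T w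

/-- The conditions (A1)-(A4) on a bifunction `F : C × C → ℝ`. -/
structure EquilibriumBifunction (C : Set E) (F : E → E → ℝ) : Prop where
  diag : ∀ x ∈ C, F x x = 0
  monotone : ∀ x ∈ C, ∀ y ∈ C, F x y + F y x ≤ 0
  upperHemicontinuous : ∀ x ∈ C, ∀ y ∈ C, ∀ z ∈ C,
    limsup (fun t : ℝ => (F (t • z + (1 - t) • x) y : EReal)) (𝓝[>] 0) ≤ (F x y : EReal)
  convex : ∀ x ∈ C, ConvexOn ℝ C (F x)
  lowerSemicontinuous : ∀ x ∈ C, LowerSemicontinuousOn (F x) C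

/-- The solution set of the equilibrium problem for `F`. -/
def EP (C : Set E) (F : E → E → ℝ) : Set E :=
  {x | x ∈ C ∧ ∀ y ∈ C, 0 ≤ F x y}

/-- The set of common fixed points of the `T i` that solve the equilibrium problem for `F`. -/
def commonSolutions (C : Set E) (F : E → E → ℝ) (T : ℕ+ → E → Set E) : Set E :=
  (⋂ i, fixedPts C (T i)) ∩ EP C F

/-- The sets `C₀ = C`, `Cₙ₊₁ = {z ∈ Cₙ : φ(z, uₙ) ≤ φ(z, xₙ)}`. -/
def shrinkingSet (C : Set E) (x u : ℕ → E) : ℕ → Set E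
  | 0 => C
  | n + 1 => {z | z ∈ shrinkingSet C x u n ∧ phi z (u n) ≤ phi z (x n)}

/-- The sequences `x`, `y`, `u`, `z` are generated by the shrinking projection algorithm with
`z n i ∈ T i (x n)` and parameters `a`, `r`, started at `x 0 ∈ C`. -/
structure IsShrinkingScheme (C : Set E) (F : E → E → ℝ) (T : ℕ+ → E → Set E)
    (a : ℕ → ℕ → ℝ) (r : ℕ → ℝ) (x y u : ℕ → E) (z : ℕ → ℕ+ → E) : Prop where
  start_mem : x 0 ∈ C
  z_mem : ∀ n i, z n i ∈ T i (x n)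
  /-- `yₙ = J⁻¹ (aₙ₀ J xₙ + ∑_{i ≥ 1} aₙᵢ J zₙᵢ)` -/
  y_eq : ∀ n, J (y n) = a n 0 • J (x n) + ∑' i : ℕ+, a n i • J (z n i)
  u_mem : ∀ n, u n ∈ C
  u_resolvent : ∀ n, ∀ v ∈ C,
    0 ≤ F (u n) v + 1 / r n * (J (u n) - J (y n)) (v - u n)
  /-- `xₙ₊₁` is the generalized projection of `x₀` on `Cₙ₊₁` -/
  x_succ : ∀ n, IsGenProj (shrinkingSet C x u (n + 1)) (x 0) (x (n + 1))

end Duality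

/-- Uniform smoothness: `lim_{t → 0} (‖x + t y‖ - ‖x‖) / t` exists uniformly for `x`, `y` in the
unit sphere. -/
def UniformlySmooth (E : Type*) [NormedAddCommGroup E] [NormedSpace ℝ E] : Prop :=
  ∃ D : E × E → ℝ, TendstoUniformlyOn
    (fun (t : ℝ) (p : E × E) => (‖p.1 + t • p.2‖ - ‖p.1‖) / t) D (𝓝[≠] 0)
    (Metric.sphere (0 : E) 1 ×ˢ Metric.sphere (0 : E) 1)

end ShrinkingProjection

/-!
Let `𝓕` be the set of common solutions. The map `φ(p, ·)`, `p ∈ 𝓕`, decreases along each step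
`xₙ ↦ yₙ ↦ uₙ`: for the resolvent this is monotonicity of `F` with the three-point identity
(`phi_resolvent_le`), and for the averaging step it is the identity
`φ(p, y) + ∑ aᵢ φ(y, qᵢ) = ∑ aᵢ φ(p, qᵢ)`, valid whenever `J y = ∑ aᵢ J qᵢ` is a convex combination
(`mul_phi_le_of_hasSum`). Hence `𝓕 ⊆ Cₙ` for all `n`.

The sets `Cₙ` are convex and decreasing, so comparing `xₙ` with midpoints and using that the squared
norm is uniformly convex on bounded sets (`exists_le_convexity_gap`) shows that `xₙ` converges to
some `w` (`cauchySeq_of_isGenProj`). Uniform convexity of the squared norm also gives that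
`sₙ` and `tₙ` have the same limit if one of them converges and `φ(sₙ, tₙ) → 0`
(`tendsto_of_phi_left`, `tendsto_of_phi_right`). As
`φ(xₙ₊₁, uₙ) ≤ φ(xₙ₊₁, xₙ) → 0`, also `uₙ → w`. Uniform smoothness makes `J` continuous from the norm
to the weak-star topology (`tendsto_J_apply`), so `φ(p, xₙ) - φ(p, uₙ) → 0`. By the identity above
this difference dominates `aₙ₀ φ(yₙ, xₙ)` and `aₙᵢ φ(yₙ, zₙᵢ)`, whence `yₙ → w` and
`zₙᵢ → w`, because `aₙ₀` and `aₙᵢ` are eventually bounded away from zero.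

Closedness of the `Tᵢ` now gives `w ∈ F(Tᵢ)`, and lower semicontinuity with Minty's lemma
(`mem_EP_of_forall_le_zero`) gives `w ∈ EP(F)`. Since `xₙ` minimizes `φ(·, x₀)` on `Cₙ ⊇ 𝓕`, its
limit `w` minimizes it on `𝓕`, and midpoints once more show that no other point does
(`eq_of_tendsto_isGenProj`).
-/

namespace ShrinkingProjection

section Auxiliary

variable {E : Type*} [NormedAddCommGroup E] [NormedSpace ℝ E]

/-! ### The duality mapping and the Lyapunov functional -/

theorem norm_J (x : E) : ‖J x‖ = ‖x‖ :=
  (dualitySet_nonempty x).some_mem.2.symm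

theorem J_apply_self (x : E) : J x x = ‖x‖ ^ 2 := by
  have h := (dualitySet_nonempty x).some_mem.1
  change J x x = ‖x‖ * ‖J x‖ at h
  rw [h, norm_J, sq]

theorem J_apply_le (x y : E) : J x y ≤ ‖x‖ * ‖y‖ := by
  have h := (J x).le_opNorm y
  rw [norm_J] at h
  exact (le_abs_self _).trans h

theorem sq_norm_sub_norm_le_phi (x y : E) : (‖x‖ - ‖y‖) ^ 2 ≤ phi x y := by
  have := J_apply_le y x
  unfold phi
  nlinarith

theorem phi_nonneg (x y : E) : 0 ≤ phi x y :=
  (sq_nonneg _).trans (sq_norm_sub_norm_le_phi x y)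

theorem phi_self (x : E) : phi x x = 0 := by
  unfold phi
  rw [J_apply_self]
  ring

theorem continuous_phi_left (y : E) : Continuous fun x => phi x y := by
  unfold phi
  fun_prop

/-- The three-point identity for `φ`. -/
theorem phi_three_point (p u y : E) :
    phi p y = phi p u + phi u y + 2 * (J u - J y) (p - u) := by
  simp only [phi, sub_apply, map_sub, J_apply_self]
  ring

/-- The sublevel comparison defining the shrinking sets is affine in the first variable. -/
theorem phi_le_phi_iff (v u x : E) :
    phi v u ≤ phi v x ↔ ‖u‖ ^ 2 - ‖x‖ ^ 2 ≤ 2 * (J u - J x) v := by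
  simp only [phi, sub_apply]
  constructor <;> intro h <;> linarith

/-- The half squared norm has subgradient `J x` at `x`. -/
theorem two_mul_J_apply_le (x y : E) : 2 * J x y ≤ ‖x + y‖ ^ 2 - ‖x‖ ^ 2 := by
  have h := J_apply_le x (x + y)
  rw [map_add, J_apply_self] at h
  nlinarith [sq_nonneg (‖x + y‖ - ‖x‖)]

/-! ### Uniform convexity of the squared norm -/

/-- The squared norm of a uniformly convex space is uniformly convex on bounded sets. -/
theorem exists_le_convexity_gap [UniformConvexSpace E] {ε R : ℝ} (hε : 0 < ε) (hR : 0 < R) :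
    ∃ δ > 0, ∀ a b : E, ‖a‖ ≤ R → ‖b‖ ≤ R → ε ≤ ‖a - b‖ →
      δ ≤ (‖a‖ ^ 2 + ‖b‖ ^ 2) / 2 - ‖(2⁻¹ : ℝ) • (a + b)‖ ^ 2 := by
  obtain ⟨δ, hδ, H⟩ := exists_forall_closed_ball_dist_add_le_two_sub E (div_pos hε hR)
  -- Put `M = (‖a‖ + ‖b‖) / 2`, `d = |‖a‖ - ‖b‖| / 2`, `h = ‖(a + b) / 2‖`; the gap is
  -- `d² + (M² - h²)`. Either `d` is at least `η`, or rescaling to the unit ball gives `h ≤ M - η`.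
  set c := δ / 2 with hc
  have hc0 : 0 < c := by positivity
  set η := c * ε / 4 with hη
  have hη0 : 0 < η := by positivity
  refine ⟨min (η ^ 2) (η * (ε / 2)), by positivity, ?_⟩
  intro a b ha hb hab
  rw [norm_smul, Real.norm_of_nonneg (by norm_num : (0 : ℝ) ≤ 2⁻¹)]
  have hsum : ε ≤ ‖a‖ + ‖b‖ := hab.trans (norm_sub_le a b)
  have htri : ‖a + b‖ ≤ ‖a‖ + ‖b‖ := norm_add_le a b
  set s := max ‖a‖ ‖b‖ with hs
  have has : ‖a‖ ≤ s := le_max_left _ _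
  have hbs : ‖b‖ ≤ s := le_max_right _ _
  have hs0 : 0 < s := by linarith
  have hsR : s ≤ R := max_le ha hb
  have hnorm (v : E) : ‖s⁻¹ • v‖ = ‖v‖ / s := by
    rw [norm_smul, norm_inv, Real.norm_of_nonneg hs0.le, div_eq_inv_mul]
  have h1 : ‖s⁻¹ • a + s⁻¹ • b‖ ≤ 2 - δ := by
    refine H (by rw [hnorm]; exact (div_le_one hs0).2 has)
      (by rw [hnorm]; exact (div_le_one hs0).2 hbs) ?_
    rw [← smul_sub, hnorm]
    exact div_le_div₀ (hε.le.trans hab) hab hs0 hsR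
  rw [← smul_add, hnorm, div_le_iff₀ hs0] at h1
  have hsd : s = (‖a‖ + ‖b‖) / 2 + |‖a‖ - ‖b‖| / 2 := by
    rcases le_total ‖a‖ ‖b‖ with h | h
    · rw [hs, max_eq_right h, abs_of_nonpos (sub_nonpos.2 h)]
      ring
    · rw [hs, max_eq_left h, abs_of_nonneg (sub_nonneg.2 h)]
      ring
  set d := |‖a‖ - ‖b‖| / 2 with hd
  have hd0 : 0 ≤ d := by positivity
  have hd2 : (‖a‖ - ‖b‖) ^ 2 = 4 * d ^ 2 := by
    rw [hd, div_pow, sq_abs]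
    ring
  have h0 := norm_nonneg (a + b)
  rcases le_total η d with hηd | hηd
  · refine (min_le_left _ _).trans ?_
    nlinarith
  · refine (min_le_right _ _).trans ?_
    have h2 : 2⁻¹ * ‖a + b‖ ≤ (‖a‖ + ‖b‖) / 2 - η := by
      have : c * (ε / 2) ≤ c * s := by
        gcongr
        linarith
      nlinarith
    nlinarith

theorem tendsto_sub_of_convexity_gap [UniformConvexSpace E] {a b : ℕ → E} {R : ℝ}
    (ha : ∀ᶠ n in atTop, ‖a n‖ ≤ R) (hb : ∀ᶠ n in atTop, ‖b n‖ ≤ R) {g : ℕ → ℝ}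
    (hg : Tendsto g atTop (𝓝 0))
    (h : ∀ n, (‖a n‖ ^ 2 + ‖b n‖ ^ 2) / 2 - ‖(2⁻¹ : ℝ) • (a n + b n)‖ ^ 2 ≤ g n) :
    Tendsto (fun n => a n - b n) atTop (𝓝 0) := by
  rw [NormedAddGroup.tendsto_nhds_zero]
  intro ε hε
  obtain ⟨δ, hδ, H⟩ := exists_le_convexity_gap (E := E) hε (R := max R 1) (by positivity)
  filter_upwards [ha, hb, hg.eventually_lt_const hδ] with n h1 h2 h3
  by_contra hn
  exact absurd ((H _ _ (h1.trans (le_max_left _ _)) (h2.trans (le_max_left _ _))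
    (not_lt.1 hn)).trans (h n)) (not_le.2 h3)

/-- The convexity gap of the squared norm at `a, b` is at most `φ(a, b) / 2`. -/
theorem convexity_gap_le_phi (a b : E) :
    (‖a‖ ^ 2 + ‖b‖ ^ 2) / 2 - ‖(2⁻¹ : ℝ) • (a + b)‖ ^ 2 ≤ phi a b / 2 := by
  have h := J_apply_le b ((2⁻¹ : ℝ) • (a + b))
  rw [map_smul, map_add, J_apply_self, smul_eq_mul] at h
  unfold phi
  nlinarith [sq_nonneg (‖(2⁻¹ : ℝ) • (a + b)‖ - ‖b‖)]

/-- In a uniformly convex space, `φ(aₙ, bₙ) → 0` lets `aₙ` inherit the limit of `bₙ`. -/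
theorem tendsto_of_phi_left [UniformConvexSpace E] {a b : ℕ → E} {w : E}
    (hb : Tendsto b atTop (𝓝 w)) (h : Tendsto (fun n => phi (a n) (b n)) atTop (𝓝 0)) :
    Tendsto a atTop (𝓝 w) := by
  have hbn : ∀ᶠ n in atTop, ‖b n‖ ≤ ‖w‖ + 2 :=
    (hb.norm.eventually_le_const (by linarith : ‖w‖ < ‖w‖ + 1)).mono fun n hn => by linarith
  have han : ∀ᶠ n in atTop, ‖a n‖ ≤ ‖w‖ + 2 := by
    filter_upwards [hb.norm.eventually_le_const (by linarith : ‖w‖ < ‖w‖ + 1),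
      h.eventually_lt_const one_pos] with n h1 h2
    have := sq_norm_sub_norm_le_phi (a n) (b n)
    nlinarith
  have := tendsto_sub_of_convexity_gap han hbn (by simpa using h.div_const 2)
    fun n => convexity_gap_le_phi (a n) (b n)
  simpa using this.add hb

/-- The analogue of `tendsto_of_phi_left` for the second argument of `φ`. -/
theorem tendsto_of_phi_right [UniformConvexSpace E] {a b : ℕ → E} {w : E}
    (ha : Tendsto a atTop (𝓝 w)) (h : Tendsto (fun n => phi (a n) (b n)) atTop (𝓝 0)) :
    Tendsto b atTop (𝓝 w) := by
  have han : ∀ᶠ n in atTop, ‖a n‖ ≤ ‖w‖ + 2 :=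
    (ha.norm.eventually_le_const (by linarith : ‖w‖ < ‖w‖ + 1)).mono fun n hn => by linarith
  have hbn : ∀ᶠ n in atTop, ‖b n‖ ≤ ‖w‖ + 2 := by
    filter_upwards [ha.norm.eventually_le_const (by linarith : ‖w‖ < ‖w‖ + 1),
      h.eventually_lt_const one_pos] with n h1 h2
    have := sq_norm_sub_norm_le_phi (a n) (b n)
    nlinarith
  have := tendsto_sub_of_convexity_gap han hbn (by simpa using h.div_const 2)
    fun n => convexity_gap_le_phi (a n) (b n)
  simpa using ha.sub this

theorem phi_tendsto_zero {a b : ℕ → E} {w : E} (ha : Tendsto a atTop (𝓝 w))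
    (hb : Tendsto b atTop (𝓝 w)) : Tendsto (fun n => phi (a n) (b n)) atTop (𝓝 0) := by
  have hlim : Tendsto (fun n => ‖a n‖ ^ 2 - ‖b n‖ ^ 2 + 2 * (‖b n‖ * ‖b n - a n‖)) atTop
      (𝓝 (‖w‖ ^ 2 - ‖w‖ ^ 2 + 2 * (‖w‖ * ‖w - w‖))) :=
    ((ha.norm.pow 2).sub (hb.norm.pow 2)).add ((hb.norm.mul (hb.sub ha).norm).const_mul 2)
  simp only [sub_self, norm_zero, mul_zero, add_zero] at hlim
  refine squeeze_zero (fun n => phi_nonneg _ _) (fun n => ?_) hlim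
  have := J_apply_le (b n) (b n - a n)
  rw [map_sub, J_apply_self] at this
  unfold phi
  linarith

/-! ### Weak-star continuity of the duality mapping -/

theorem hasDerivAt_norm_add_smul (hE : UniformlySmooth E) {x : E} (hx : x ≠ 0) (y : E) :
    ∃ d, HasDerivAt (fun t : ℝ => ‖x + t • y‖) d 0 := by
  rcases eq_or_ne y 0 with rfl | hy
  · exact ⟨0, by simpa using hasDerivAt_const (0 : ℝ) ‖x‖⟩
  obtain ⟨D, hD⟩ := hE
  have hx0 : 0 < ‖x‖ := norm_pos_iff.2 hx
  have hy0 : 0 < ‖y‖ := norm_pos_iff.2 hy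
  have hmem : (‖x‖⁻¹ • x, ‖y‖⁻¹ • y) ∈
      Metric.sphere (0 : E) 1 ×ˢ Metric.sphere (0 : E) 1 := by
    simp [norm_smul, hx0.ne', hy0.ne']
  have hunit : HasDerivAt (fun t : ℝ => ‖‖x‖⁻¹ • x + t • ‖y‖⁻¹ • y‖)
      (D (‖x‖⁻¹ • x, ‖y‖⁻¹ • y)) 0 := by
    rw [hasDerivAt_iff_tendsto_slope]
    refine (hD.tendsto_at hmem).congr fun t => ?_
    simp [slope_def_field]
  have hscale : HasDerivAt (fun t : ℝ => t * (‖y‖ / ‖x‖)) (‖y‖ / ‖x‖) 0 := by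
    simpa using (hasDerivAt_id (0 : ℝ)).mul_const (‖y‖ / ‖x‖)
  have hunit' : HasDerivAt (fun t : ℝ => ‖‖x‖⁻¹ • x + t • ‖y‖⁻¹ • y‖)
      (D (‖x‖⁻¹ • x, ‖y‖⁻¹ • y)) ((fun t : ℝ => t * (‖y‖ / ‖x‖)) 0) := by
    simpa using hunit
  refine ⟨_, ((hunit'.comp 0 hscale).const_mul ‖x‖).congr_of_eventuallyEq
    (Eventually.of_forall fun t => ?_)⟩
  have : x + t • y = ‖x‖ • (‖x‖⁻¹ • x + (t * (‖y‖ / ‖x‖)) • ‖y‖⁻¹ • y) := by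
    rw [smul_add, smul_inv_smul₀ hx0.ne', smul_smul, smul_smul]
    congr 2
    field_simp
  simp only [Function.comp]
  nth_rewrite 1 [this]
  rw [norm_smul, norm_norm]

theorem hasDerivAt_sq_norm_add_smul (hE : UniformlySmooth E) (x y : E) :
    ∃ d, HasDerivAt (fun t : ℝ => ‖x + t • y‖ ^ 2) d 0 := by
  rcases eq_or_ne x 0 with rfl | hx
  · refine ⟨_, (((hasDerivAt_id (0 : ℝ)).pow 2).mul_const (‖y‖ ^ 2)).congr_of_eventuallyEq
      (Eventually.of_forall fun t => ?_)⟩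
    simp [norm_smul, mul_pow]
  · obtain ⟨d, hd⟩ := hasDerivAt_norm_add_smul hE hx y
    exact ⟨_, hd.pow 2⟩

/-- If the squared norm has derivative `d` at `w` in direction `y`, then `2 ⟨y, J xₙ⟩ → d` whenever
`xₙ → w`: the difference quotients at `xₙ` bound `2 ⟨y, J xₙ⟩` from both sides, and for a fixed
step they converge to those at `w`. -/
theorem tendsto_two_mul_J_apply {w y : E} {d : ℝ}
    (hd : HasDerivAt (fun t : ℝ => ‖w + t • y‖ ^ 2) d 0) {x : ℕ → E}
    (hx : Tendsto x atTop (𝓝 w)) : Tendsto (fun n => 2 * J (x n) y) atTop (𝓝 d) := by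
  rw [hasDerivAt_iff_tendsto_slope] at hd
  have hq (t : ℝ) : Tendsto (fun n => (‖x n + t • y‖ ^ 2 - ‖x n‖ ^ 2) / t) atTop
      (𝓝 (slope (fun t : ℝ => ‖w + t • y‖ ^ 2) 0 t)) := by
    have : slope (fun t : ℝ => ‖w + t • y‖ ^ 2) 0 t = (‖w + t • y‖ ^ 2 - ‖w‖ ^ 2) / t := by
      simp [slope_def_field]
    rw [this]
    exact (((hx.add_const _).norm.pow 2).sub (hx.norm.pow 2)).div_const t
  have hsub (t : ℝ) (n : ℕ) : t * (2 * J (x n) y) ≤ ‖x n + t • y‖ ^ 2 - ‖x n‖ ^ 2 := by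
    have := two_mul_J_apply_le (x n) (t • y)
    rw [map_smul, smul_eq_mul] at this
    linarith
  refine tendsto_order.2 ⟨fun b hb => ?_, fun b hb => ?_⟩
  · have h1 : ∀ᶠ t in 𝓝[<] (0 : ℝ), b < slope (fun t : ℝ => ‖w + t • y‖ ^ 2) 0 t :=
      (hd.mono_left (nhdsWithin_mono _ fun t ht => ne_of_lt ht)).eventually_const_lt hb
    obtain ⟨t, htb, ht⟩ := (h1.and self_mem_nhdsWithin).exists
    have ht' : t < 0 := ht
    filter_upwards [(hq t).eventually_const_lt htb] with n hn
    refine hn.trans_le ((div_le_iff_of_neg ht').2 ?_)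
    linarith [hsub t n]
  · have h1 : ∀ᶠ t in 𝓝[>] (0 : ℝ), slope (fun t : ℝ => ‖w + t • y‖ ^ 2) 0 t < b :=
      (hd.mono_left (nhdsWithin_mono _ fun t ht => ne_of_gt ht)).eventually_lt_const hb
    obtain ⟨t, htb, ht⟩ := (h1.and self_mem_nhdsWithin).exists
    have ht' : 0 < t := ht
    filter_upwards [(hq t).eventually_lt_const htb] with n hn
    refine lt_of_le_of_lt ((le_div_iff₀ ht').2 ?_) hn
    linarith [hsub t n]

/-- In a uniformly smooth space, `J` is sequentially continuous from the norm topology to the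
weak-star topology. -/
theorem tendsto_J_apply (hE : UniformlySmooth E) {x : ℕ → E} {w : E}
    (hx : Tendsto x atTop (𝓝 w)) (y : E) : Tendsto (fun n => J (x n) y) atTop (𝓝 (J w y)) := by
  obtain ⟨d, hd⟩ := hasDerivAt_sq_norm_add_smul hE w y
  have h1 := tendsto_two_mul_J_apply hd hx
  have h2 : 2 * J w y = d := tendsto_nhds_unique tendsto_const_nhds
    (tendsto_two_mul_J_apply hd (tendsto_const_nhds (x := w)))
  rw [← h2] at h1
  simpa using h1.const_mul 2⁻¹

theorem tendsto_J_apply_apply (hE : UniformlySmooth E) {x v : ℕ → E} {w v₀ : E}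
    (hx : Tendsto x atTop (𝓝 w)) (hv : Tendsto v atTop (𝓝 v₀)) :
    Tendsto (fun n => J (x n) (v n)) atTop (𝓝 (J w v₀)) := by
  have h1 : Tendsto (fun n => J (x n) (v n - v₀)) atTop (𝓝 0) := by
    have h2 : Tendsto (fun n => ‖x n‖ * ‖v n - v₀‖) atTop (𝓝 (‖w‖ * ‖v₀ - v₀‖)) :=
      hx.norm.mul (hv.sub_const v₀).norm
    rw [sub_self, norm_zero, mul_zero] at h2
    refine squeeze_zero_norm (fun n => ?_) h2
    have := (J (x n)).le_opNorm (v n - v₀)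
    rwa [norm_J] at this
  simpa using h1.add (tendsto_J_apply hE hx v₀)

/-! ### Generalized projections and convex combinations in the dual -/

/-- Comparing a generalized projection with a midpoint bounds the convexity gap of the squared
norm. -/
theorem IsGenProj.convexity_gap_le {D : Set E} (hD : Convex ℝ D) {x₀ p q : E}
    (hp : IsGenProj D x₀ p) (hq : q ∈ D) :
    (‖p‖ ^ 2 + ‖q‖ ^ 2) / 2 - ‖(2⁻¹ : ℝ) • (p + q)‖ ^ 2 ≤ (phi q x₀ - phi p x₀) / 2 := by
  have hm : (2⁻¹ : ℝ) • (p + q) ∈ D := by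
    rw [smul_add]
    exact hD hp.1 hq (by norm_num) (by norm_num) (by norm_num)
  have h := hp.2 _ hm
  simp only [phi, map_smul, map_add, smul_eq_mul] at h ⊢
  linarith

/-- If `J y = ∑ aᵢ J qᵢ` is a convex combination, then
`φ(p, y) + ∑ aᵢ φ(y, qᵢ) = ∑ aᵢ φ(p, qᵢ)`; hence each `aᵢ φ(y, qᵢ)` is controlled by the decrease
of `φ(p, ·)`. -/
theorem mul_phi_le_of_hasSum {a : ℕ → ℝ} (ha0 : ∀ i, 0 ≤ a i) (ha : HasSum a 1) {q : ℕ → E}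
    {y p : E} {M : ℝ} (hy : HasSum (fun i => a i • J (q i)) (J y)) (hM : ∀ i, phi p (q i) ≤ M)
    (i : ℕ) : a i * phi y (q i) ≤ M - phi p y := by
  have h1 : HasSum (fun i => a i * J (q i) (p - y)) (J y (p - y)) := by
    simpa using hy.mapL (ContinuousLinearMap.apply ℝ ℝ (p - y))
  have h2 : HasSum (fun i => a i * (M - phi p (q i) + phi y (q i))) (M - phi p y) := by
    have h3 := (ha.mul_right (M - ‖p‖ ^ 2 + ‖y‖ ^ 2)).add (h1.mul_left 2)
    have h4 (j : ℕ) : a j * (M - phi p (q j) + phi y (q j)) =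
        a j * (M - ‖p‖ ^ 2 + ‖y‖ ^ 2) + 2 * (a j * J (q j) (p - y)) := by
      simp only [phi, map_sub]
      ring
    have h5 : M - phi p y = 1 * (M - ‖p‖ ^ 2 + ‖y‖ ^ 2) + 2 * J y (p - y) := by
      simp only [phi, map_sub, J_apply_self]
      ring
    simpa only [h4, h5] using h3
  have h6 := le_hasSum h2 i fun j _ =>
    mul_nonneg (ha0 j) (add_nonneg (sub_nonneg.2 (hM j)) (phi_nonneg _ _))
  refine le_trans (mul_le_mul_of_nonneg_left ?_ (ha0 i)) h6
  linarith [hM i]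

theorem norm_le_of_phi_le {p q : E} {M : ℝ} (h : phi p q ≤ M) : ‖q‖ ≤ ‖p‖ + (M + 1) := by
  have h1 := (sq_norm_sub_norm_le_phi p q).trans h
  nlinarith [sq_nonneg (‖p‖ - ‖q‖ + 1)]

theorem norm_le_of_phi_le' {p q : E} {M : ℝ} (h : phi p q ≤ M) : ‖p‖ ≤ ‖q‖ + (M + 1) := by
  have h1 := (sq_norm_sub_norm_le_phi p q).trans h
  nlinarith [sq_nonneg (‖p‖ - ‖q‖ - 1)]

/-- `mul_phi_le_of_hasSum` for the series defining `yₙ`, whose summability is part of the proof. -/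
theorem mul_phi_le_of_eq_tsum {a : ℕ → ℝ} (ha0 : ∀ i, 0 ≤ a i) (ha : HasSum a 1)
    {x y p : E} {z : ℕ+ → E} (hy : J y = a 0 • J x + ∑' i : ℕ+, a i • J (z i))
    (hz : ∀ i, phi p (z i) ≤ phi p x) :
    a 0 * phi y x ≤ phi p x - phi p y ∧ ∀ i : ℕ+, a i * phi y (z i) ≤ phi p x - phi p y := by
  set q : ℕ → E := fun m => if h : 0 < m then z ⟨m, h⟩ else x with hq
  have hq0 : q 0 = x := by simp [hq]
  have hqi (i : ℕ+) : q i = z i := dif_pos i.pos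
  have hqle (m : ℕ) : phi p (q m) ≤ phi p x := by
    by_cases h : 0 < m
    · simpa [hq, h] using hz ⟨m, h⟩
    · simp [hq, h]
  have hsum : Summable fun m => a m • J (q m) := by
    refine Summable.of_norm_bounded (ha.summable.mul_right (‖p‖ + (phi p x + 1))) fun m => ?_
    rw [norm_smul, Real.norm_of_nonneg (ha0 m), norm_J]
    exact mul_le_mul_of_nonneg_left (norm_le_of_phi_le (hqle m)) (ha0 m)
  have hJy : HasSum (fun m => a m • J (q m)) (J y) := by
    rw [hy]
    convert hsum.hasSum using 1
    rw [hsum.tsum_eq_zero_add, hq0, ← tsum_pnat_eq_tsum_succ (f := fun m => a m • J (q m))]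
    simp only [hqi]
  have key := mul_phi_le_of_hasSum ha0 ha hJy hqle
  refine ⟨by simpa only [hq0] using key 0, fun i => by simpa only [hqi] using key i⟩

/-! ### Monotone sequences of generalized projections -/

/-- `φ(xₙ, x₀)` is monotone and bounded, and the midpoint of `x_N` and `xₙ`, `n ≥ N`, lies in
`D_N`, so the convexity gap of the squared norm at `x_N, xₙ` tends to zero. -/
theorem cauchySeq_of_isGenProj [UniformConvexSpace E] {D : ℕ → Set E} (hD : Antitone D)
    (hconv : ∀ n, Convex ℝ (D n)) {x₀ p : E} {x : ℕ → E} (hx : ∀ n, IsGenProj (D n) x₀ (x n))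
    (hp : ∀ n, p ∈ D n) : CauchySeq x := by
  have hmono : Monotone fun n => phi (x n) x₀ := fun m n hmn => (hx m).2 _ (hD hmn (hx n).1)
  have hbdd : BddAbove (Set.range fun n => phi (x n) x₀) :=
    ⟨phi p x₀, by rintro _ ⟨n, rfl⟩; exact (hx n).2 p (hp n)⟩
  have hlim := tendsto_atTop_ciSup hmono hbdd
  set s := ⨆ n, phi (x n) x₀
  have hle (n : ℕ) : phi (x n) x₀ ≤ s := le_ciSup hbdd n
  have hnorm (n : ℕ) : ‖x n‖ ≤ max (‖x₀‖ + (phi p x₀ + 1)) 1 :=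
    (norm_le_of_phi_le' ((hx n).2 p (hp n))).trans (le_max_left _ _)
  rw [Metric.cauchySeq_iff']
  intro ε hε
  obtain ⟨δ, hδ, H⟩ := exists_le_convexity_gap (E := E) hε
    (R := max (‖x₀‖ + (phi p x₀ + 1)) 1) (by positivity)
  obtain ⟨N, hN⟩ := (hlim.eventually_const_lt (by linarith : s - δ < s)).exists
  refine ⟨N, fun n hn => ?_⟩
  by_contra hlt
  rw [dist_comm, dist_eq_norm, not_lt] at hlt
  have h1 := H _ _ (hnorm N) (hnorm n) hlt
  have h2 := (hx N).convexity_gap_le (hconv N) (hD hn (hx n).1)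
  linarith [hle n]

/-- The limit `w` of the generalized projections is the only point of the intersection of the sets
at which `φ(·, x₀)` is at most `φ(w, x₀)`. -/
theorem eq_of_tendsto_isGenProj [UniformConvexSpace E] {D : ℕ → Set E}
    (hconv : ∀ n, Convex ℝ (D n)) {x₀ w q : E} {x : ℕ → E}
    (hx : ∀ n, IsGenProj (D n) x₀ (x n)) (hw : Tendsto x atTop (𝓝 w)) (hq : ∀ n, q ∈ D n)
    (hle : phi q x₀ ≤ phi w x₀) : q = w := by
  have hg : Tendsto (fun n => (phi w x₀ - phi (x n) x₀) / 2) atTop (𝓝 0) := by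
    have := (((continuous_phi_left x₀).tendsto w).comp hw).const_sub (phi w x₀)
    simpa using this.div_const 2
  have h := tendsto_sub_of_convexity_gap (a := x) (b := fun _ => q) (R := ‖w‖ + 1 + ‖q‖)
    ((hw.norm.eventually_le_const (by linarith : ‖w‖ < ‖w‖ + 1)).mono fun n hn => by
      linarith [norm_nonneg q])
    (Eventually.of_forall fun n => by linarith [norm_nonneg w]) hg fun n => by
      have := (hx n).convexity_gap_le (hconv n) (hq n)
      linarith
  have h2 := h.add_const q
  simp only [sub_add_cancel, zero_add] at h2
  exact tendsto_nhds_unique h2 hw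

theorem antitone_shrinkingSet (C : Set E) (x u : ℕ → E) : Antitone (shrinkingSet C x u) :=
  antitone_nat_of_succ_le fun _ _ hv => hv.1

theorem convex_shrinkingSet {C : Set E} (hC : Convex ℝ C) (x u : ℕ → E) (n : ℕ) :
    Convex ℝ (shrinkingSet C x u n) := by
  induction n with
  | zero => exact hC
  | succ n ih =>
    refine ih.inter (t := {v | phi v (u n) ≤ phi v (x n)}) ?_
    simp only [phi_le_phi_iff]
    exact convex_halfSpace_ge ((2 : ℝ) • (J (u n) - J (x n))).isLinear _

theorem mem_shrinkingSet {C : Set E} {x u : ℕ → E} {p : E} (hp : p ∈ C)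
    (h : ∀ n, phi p (u n) ≤ phi p (x n)) (n : ℕ) : p ∈ shrinkingSet C x u n := by
  induction n with
  | zero => exact hp
  | succ n ih => exact ⟨ih, h n⟩

theorem shrinkingSet_subset (C : Set E) (x u : ℕ → E) (n : ℕ) : shrinkingSet C x u n ⊆ C :=
  antitone_shrinkingSet C x u (Nat.zero_le n)

/-! ### Equilibrium problems -/

/-- A resolvent step towards a solution of the equilibrium problem does not increase `φ(p, ·)`. -/
theorem phi_resolvent_le {C : Set E} {F : E → E → ℝ} (hF : EquilibriumBifunction C F) {p u y : E}
    {r : ℝ} (hr : 0 < r) (hp : p ∈ EP C F) (hu : u ∈ C)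
    (h : 0 ≤ F u p + 1 / r * (J u - J y) (p - u)) : phi p u ≤ phi p y := by
  have h1 := hF.monotone p hp.1 u hu
  have h2 := hp.2 u hu
  have h3 : 0 ≤ 1 / r * (J u - J y) (p - u) := by linarith
  have h4 : 0 ≤ (J u - J y) (p - u) := nonneg_of_mul_nonneg_right h3 (by positivity)
  have := phi_three_point p u y
  linarith [phi_nonneg u y]

/-- Minty's lemma for equilibrium problems. -/
theorem mem_EP_of_forall_le_zero {C : Set E} (hC : Convex ℝ C) {F : E → E → ℝ}
    (hF : EquilibriumBifunction C F) {w : E} (hw : w ∈ C) (h : ∀ v ∈ C, F v w ≤ 0) :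
    w ∈ EP C F := by
  refine ⟨hw, fun v hv => ?_⟩
  have hpos : ∀ᶠ t : ℝ in 𝓝[>] 0, (0 : EReal) ≤ (F (t • v + (1 - t) • w) v : EReal) := by
    filter_upwards [Ioo_mem_nhdsGT (zero_lt_one (α := ℝ))] with t ht
    have hm : t • v + (1 - t) • w ∈ C := hC hv hw ht.1.le (by linarith [ht.2]) (by ring)
    have h1 := (hF.convex _ hm).2 hv hw ht.1.le (by linarith [ht.2] : 0 ≤ 1 - t) (by ring)
    rw [hF.diag _ hm, smul_eq_mul, smul_eq_mul] at h1
    have h2 := mul_nonpos_of_nonneg_of_nonpos (by linarith [ht.2] : 0 ≤ 1 - t) (h _ hm)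
    exact_mod_cast nonneg_of_mul_nonneg_right (by linarith : 0 ≤ t * _) ht.1
  have h3 := (le_limsup_of_frequently_le' hpos.frequently).trans
    (hF.upperHemicontinuous w hw v hv v hv)
  exact_mod_cast h3

/-- Lower semicontinuity along a sequence whose values have a vanishing upper bound. -/
theorem EquilibriumBifunction.le_zero_of_tendsto {C : Set E} {F : E → E → ℝ}
    (hF : EquilibriumBifunction C F) {v w : E} (hv : v ∈ C) (hw : w ∈ C) {u : ℕ → E}
    (hu : ∀ n, u n ∈ C) (hlim : Tendsto u atTop (𝓝 w)) {e : ℕ → ℝ}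
    (he : Tendsto e atTop (𝓝 0)) (h : ∀ n, F v (u n) ≤ e n) : F v w ≤ 0 := by
  by_contra! hpos
  have h1 : ∀ᶠ n in atTop, F v w / 2 < F v (u n) :=
    (tendsto_nhdsWithin_iff.2 ⟨hlim, Eventually.of_forall hu⟩).eventually
      (hF.lowerSemicontinuous v hv w hw _ (half_lt_self hpos))
  obtain ⟨n, hn1, hn2⟩ := (h1.and (he.eventually_lt_const (half_pos hpos))).exists
  linarith [h n]

/-! ### Convergence of the algorithm -/

theorem exists_pos_eventually_lt_of_liminf_pos {f : ℕ → ℝ}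
    (h : 0 < liminf (fun n => (f n : EReal)) atTop) : ∃ c > 0, ∀ᶠ n in atTop, c < f n := by
  obtain ⟨c, hc0, hc⟩ := EReal.lt_iff_exists_real_btwn.1 h
  refine ⟨c, by exact_mod_cast hc0, (eventually_lt_of_lt_liminf hc).mono fun n hn => ?_⟩
  exact_mod_cast hn

theorem phi_le_of_Phi_singleton_le {B : Set E} {p q : E} {M : ℝ} (h : Phi {p} B ≤ (M : EReal))
    (hq : q ∈ B) : phi p q ≤ M := by
  have h1 : (phi p q : EReal) ≤ ⨆ q ∈ B, ⨅ y ∈ ({p} : Set E), (phi y q : EReal) := by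
    simp only [Set.mem_singleton_iff, iInf_iInf_eq_left]
    exact le_iSup₂ (f := fun q (_ : q ∈ B) => (phi p q : EReal)) q hq
  exact_mod_cast (h1.trans (le_max_left _ _)).trans h

theorem tendsto_zero_of_mul_le {c : ℝ} (hc : 0 < c) {b f g : ℕ → ℝ}
    (hb : ∀ᶠ n in atTop, c < b n) (hf : ∀ n, 0 ≤ f n) (h : ∀ n, b n * f n ≤ g n)
    (hg : Tendsto g atTop (𝓝 0)) : Tendsto f atTop (𝓝 0) := by
  refine squeeze_zero' (Eventually.of_forall hf) ?_ (by simpa using hg.div_const c)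
  filter_upwards [hb] with n hn
  rw [le_div_iff₀ hc]
  nlinarith [h n, hf n]

end Auxiliary

end ShrinkingProjection

open ShrinkingProjection in
theorem theorem3p2 {E : Type*} [NormedAddCommGroup E] [NormedSpace ℝ E] [CompleteSpace E]
    [UniformConvexSpace E] (hE : ShrinkingProjection.UniformlySmooth E)
    (C : Set E) (hC_ne : C.Nonempty) (hC_closed : IsClosed C) (hC_convex : Convex ℝ C)
    (F : E → E → ℝ) (hF : ShrinkingProjection.EquilibriumBifunction C F)
    (T : ℕ+ → E → Set E)
    (hT_map : ∀ i, ShrinkingProjection.IsMultiMap C (T i))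
    (hT_closed : ∀ i, ShrinkingProjection.ClosedMulti C (T i))
    (hT_rqn : ∀ i, ShrinkingProjection.RelQuasiNonexpansive C (T i))
    (h_ne : (ShrinkingProjection.commonSolutions C F T).Nonempty)
    (hT_single : ∀ p ∈ ShrinkingProjection.commonSolutions C F T, ∀ i, T i p = {p})
    (a : ℕ → ℕ → ℝ) (ha_nonneg : ∀ n i, 0 ≤ a n i) (ha_sum : ∀ n, HasSum (a n) 1)
    (ha_liminf : ∀ i : ℕ+, 0 < liminf (fun n => ((a n 0 * a n i : ℝ) : EReal)) atTop)
    (r : ℕ → ℝ) (hr_pos : ∀ n, 0 < r n)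
    (hr_liminf : 0 < liminf (fun n => (r n : EReal)) atTop)
    (x y u : ℕ → E) (z : ℕ → ℕ+ → E)
    (h_scheme : ShrinkingProjection.IsShrinkingScheme C F T a r x y u z) :
    ∃ p : E, ShrinkingProjection.IsGenProj (ShrinkingProjection.commonSolutions C F T) (x 0) p ∧
      (∀ q, ShrinkingProjection.IsGenProj (ShrinkingProjection.commonSolutions C F T) (x 0) q →
        q = p) ∧
      Tendsto x atTop (𝓝 p) := by
  obtain ⟨p, hp⟩ := h_ne
  have ha_le (n i : ℕ) : a n i ≤ 1 := le_hasSum (ha_sum n) i fun j _ => ha_nonneg n j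
  have hxC (n : ℕ) : x n ∈ C := by
    cases n with
    | zero => exact h_scheme.start_mem
    | succ n => exact shrinkingSet_subset C x u _ (h_scheme.x_succ n).1
  have hz {q : E} (hq : q ∈ commonSolutions C F T) (n : ℕ) (i : ℕ+) :
      phi q (z n i) ≤ phi q (x n) := by
    have h := (hT_rqn i).2 q (Set.mem_iInter.1 hq.1 i) (x n) (hxC n)
    rw [hT_single q hq i] at h
    exact phi_le_of_Phi_singleton_le h (h_scheme.z_mem n i)
  have hy {q : E} (hq : q ∈ commonSolutions C F T) (n : ℕ) :=
    mul_phi_le_of_eq_tsum (ha_nonneg n) (ha_sum n) (h_scheme.y_eq n) (hz hq n)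
  have huy {q : E} (hq : q ∈ commonSolutions C F T) (n : ℕ) : phi q (u n) ≤ phi q (y n) :=
    phi_resolvent_le hF (hr_pos n) hq.2 (h_scheme.u_mem n)
      (h_scheme.u_resolvent n q hq.2.1)
  have hyx {q : E} (hq : q ∈ commonSolutions C F T) (n : ℕ) : phi q (y n) ≤ phi q (x n) := by
    linarith [(hy hq n).1, mul_nonneg (ha_nonneg n 0) (phi_nonneg (y n) (x n))]
  have hmem {q : E} (hq : q ∈ commonSolutions C F T) (n : ℕ) : q ∈ shrinkingSet C x u n :=
    mem_shrinkingSet hq.2.1 (fun n => (huy hq n).trans (hyx hq n)) n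
  have hproj (n : ℕ) : IsGenProj (shrinkingSet C x u n) (x 0) (x n) := by
    cases n with
    | zero => exact ⟨h_scheme.start_mem, fun v _ => (phi_self (x 0)).trans_le (phi_nonneg _ _)⟩
    | succ n => exact h_scheme.x_succ n
  have hconv := convex_shrinkingSet hC_convex x u
  obtain ⟨w, hw⟩ := cauchySeq_tendsto_of_complete
    (cauchySeq_of_isGenProj (antitone_shrinkingSet C x u) hconv hproj (hmem hp))
  have hwC : w ∈ C := hC_closed.mem_of_tendsto hw (Eventually.of_forall hxC)
  have hw' : Tendsto (fun n => x (n + 1)) atTop (𝓝 w) := hw.comp (tendsto_add_atTop_nat 1)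
  have hu : Tendsto u atTop (𝓝 w) :=
    tendsto_of_phi_right hw' (squeeze_zero (fun n => phi_nonneg _ _)
      (fun n => (h_scheme.x_succ n).1.2) (phi_tendsto_zero hw' hw))
  -- The decrease of `φ(p, ·)` in one step tends to zero, since `J xₙ - J uₙ → 0` weakly-star.
  have hdec : Tendsto (fun n => phi p (x n) - phi p (u n)) atTop (𝓝 0) := by
    have h1 {s : ℕ → E} (hs : Tendsto s atTop (𝓝 w)) :
        Tendsto (fun n => phi p (s n)) atTop (𝓝 (phi p w)) :=
      (((tendsto_J_apply hE hs p).const_mul 2).const_sub _).add (hs.norm.pow 2)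
    simpa using (h1 hw).sub (h1 hu)
  have hlow (i : ℕ+) : ∃ c > 0, (∀ᶠ n in atTop, c < a n 0) ∧ ∀ᶠ n in atTop, c < a n i := by
    obtain ⟨c, hc, h⟩ := exists_pos_eventually_lt_of_liminf_pos (ha_liminf i)
    exact ⟨c, hc, h.mono fun n hn => by nlinarith [ha_nonneg n 0, ha_le n i],
      h.mono fun n hn => by nlinarith [ha_nonneg n i, ha_le n 0]⟩
  have hylim : Tendsto y atTop (𝓝 w) := by
    obtain ⟨c, hc, h0, -⟩ := hlow 1
    refine tendsto_of_phi_left hw (tendsto_zero_of_mul_le hc h0 (fun n => phi_nonneg _ _)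
      (fun n => ?_) hdec)
    linarith [(hy hp n).1, huy hp n]
  have hzlim (i : ℕ+) : Tendsto (fun n => z n i) atTop (𝓝 w) := by
    obtain ⟨c, hc, -, hi⟩ := hlow i
    refine tendsto_of_phi_right hylim (tendsto_zero_of_mul_le hc hi (fun n => phi_nonneg _ _)
      (fun n => ?_) hdec)
    linarith [(hy hp n).2 i, huy hp n]
  have hfix (i : ℕ+) : w ∈ fixedPts C (T i) := by
    refine ⟨hwC, hT_closed i x w hxC hwC hw ?_⟩
    refine squeeze_zero (fun n => Metric.infDist_nonneg)
      (fun n => Metric.infDist_le_dist_of_mem (h_scheme.z_mem n i)) ?_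
    simpa using hw.dist (hzlim i)
  have hEP : w ∈ EP C F := by
    refine mem_EP_of_forall_le_zero hC_convex hF hwC fun v hv => ?_
    refine hF.le_zero_of_tendsto hv hwC h_scheme.u_mem hu
      (e := fun n => 1 / r n * (J (u n) - J (y n)) (v - u n)) ?_ fun n => ?_
    · obtain ⟨c, hc, hrc⟩ := exists_pos_eventually_lt_of_liminf_pos hr_liminf
      have hv' : Tendsto (fun n => v - u n) atTop (𝓝 (v - w)) := hu.const_sub v
      have h1 : Tendsto (fun n => (J (u n) - J (y n)) (v - u n)) atTop (𝓝 0) := by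
        simpa using (tendsto_J_apply_apply hE hu hv').sub (tendsto_J_apply_apply hE hylim hv')
      rw [tendsto_zero_iff_norm_tendsto_zero] at h1 ⊢
      refine tendsto_zero_of_mul_le hc hrc (fun n => norm_nonneg _) (fun n => ?_) h1
      rw [norm_mul, Real.norm_of_nonneg (one_div_nonneg.2 (hr_pos n).le), ← mul_assoc,
        mul_one_div_cancel (hr_pos n).ne', one_mul]
    · linarith [h_scheme.u_resolvent n v hv, hF.monotone v hv (u n) (h_scheme.u_mem n)]
  have hwS : w ∈ commonSolutions C F T := ⟨Set.mem_iInter.2 hfix, hEP⟩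
  refine ⟨w, ⟨hwS, fun q hq => ?_⟩, fun q hq => ?_, hw⟩
  · exact le_of_tendsto (((continuous_phi_left (x 0)).tendsto w).comp hw)
      (Eventually.of_forall fun n => (hproj n).2 q (hmem hq n))
  · exact eq_of_tendsto_isGenProj hconv hproj hw (hmem hq.1) (hq.2 w hwS)
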